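/- An interior algebra is a Boolean algebra with an operation $\Box$ such that $\Box 1=1$, $\Box(a\wedge b)=\Box a\wedge\Box b$, $\Box a\le a$ and $\Box a\le\Box\Box a$; an element $a$ is open if $\Box a=a$. Formulas are built from propositional variables by $\wedge,\vee,\to,\neg,\Box$; a formula is valid in an algebra if it takes the value $1$ under every valuation, and the variety defined (axiomatized) by a set $\Gamma$ of formulas is the class of all interior algebras in which every formula of $\Gamma$ is valid. We write $A\Rrightarrow B$ for $\Box A\to\Box B$. The opremum of a subdirectly irreducible interior algebra is its greatest open element different from $1$. Let $\mathcal M$ be a variety of interior algebras. A formula $A(p_1,\dots,p_n)$ and a valuation $\nu$ in an algebra $\mathfrak A$ define $\mathfrak A$ over $\mathcal M$ if $\nu(p_1),\dots,\nu(p_n)$ generate $\mathfrak A$, $\nu(A)=1$, and for every formula $B(p_1,\dots,p_n)$ with $\nu(B)=1$ the formula $A\Rrightarrow B$ is valid in all algebras of $\mathcal M$. If moreover $\mathfrak A\in\mathcal M$ is subdirectly irreducible and $B(p_1,\dots,p_n)$ is a formula for which $\nu(B)$ is the opremum of $\mathfrak A$, then $A\Rrightarrow B$ is called a characteristic formula of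 $\mathfrak A$ over $\mathcal M$. For a finite subdirectly irreducible interior algebra $\mathfrak A=\{a_1,\dots,a_n\}$ with opremum $a_k$, the Jankov formula of $\mathfrak A$ is $D\Rrightarrow p_k$, where $D(p_1,\dots,p_n)$ is the diagram formula of $\mathfrak A$, i.e. the conjunction of all formulas $(p_i\circ p_j)\leftrightarrow p_l$ with $a_i\circ a_j=a_l$, $\circ\in\{\wedge,\vee,\to\}$, and all formulas $\neg p_i\leftrightarrow p_l$ with $\neg a_i=a_l$ and $\Box p_i\leftrightarrow p_l$ with $\Box a_i=a_l$. Theorem. There is a continuum of varieties of interior algebras that are defined by characteristic formulas but cannot be axiomatized by Jankov formulas. More precisely, there is a variety $\mathcal M$ of interior algebras such that the set of those varieties of interior algebras that are defined by a set of characteristic formulas, over $\mathcal M$, of infinite algebras, but are not defined by any set of Jankov formulas, has cardinality $2^{\aleph_0}$. -/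

import Mathlib

universe u

/-- Interior algebras (topological Boolean algebras, `S4`-algebras): a Boolean algebra with an
interior operator. The one-element algebra is allowed. -/
class InteriorAlgebra (α : Type u) extends BooleanAlgebra α where
  box : α → α
  box_top : box ⊤ = ⊤
  box_inf : ∀ a b : α, box (a ⊓ b) = box a ⊓ box b
  box_le : ∀ a : α, box a ≤ a
  box_le_box_box : ∀ a : α, box a ≤ box (box a)

namespace InteriorAlgebra

/-- A bundled interior algebra. -/
structure Alg : Type (u + 1) where
  carrier : Type u
  [str : InteriorAlgebra carrier]

instance : CoeSort Alg.{u} (Type u) := ⟨Alg.carrier⟩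

instance (𝔄 : Alg.{u}) : InteriorAlgebra 𝔄 := 𝔄.str

/-! ### Congruences, subdirect irreducibility, generation -/

/-- Congruences of an interior algebra. -/
structure IsCongruence {α : Type u} [InteriorAlgebra α] (r : Setoid α) : Prop where
  inf : ∀ a b c d, r a b → r c d → r (a ⊓ c) (b ⊓ d)
  sup : ∀ a b c d, r a b → r c d → r (a ⊔ c) (b ⊔ d)
  himp : ∀ a b c d, r a b → r c d → r (a ⇨ c) (b ⇨ d)
  compl : ∀ a b, r a b → r aᶜ bᶜ
  box : ∀ a b, r a b → r (box a) (box b)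

/-- Subdirect irreducibility: there is a least congruence among those different from the identity
relation (so a one-element algebra is not subdirectly irreducible). -/
def IsSubdirectlyIrreducible (α : Type u) [InteriorAlgebra α] : Prop :=
  ∃ μ : Setoid α, IsCongruence μ ∧ μ ≠ ⊥ ∧
    ∀ θ : Setoid α, IsCongruence θ → θ ≠ ⊥ → μ ≤ θ

/-- `S` is the universe of a subalgebra (if it is nonempty). -/
structure IsSubuniverse {α : Type u} [InteriorAlgebra α] (S : Set α) : Prop where
  inf : ∀ a ∈ S, ∀ b ∈ S, a ⊓ b ∈ S
  sup : ∀ a ∈ S, ∀ b ∈ S, a ⊔ b ∈ S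
  himp : ∀ a ∈ S, ∀ b ∈ S, a ⇨ b ∈ S
  compl : ∀ a ∈ S, aᶜ ∈ S
  box : ∀ a ∈ S, box a ∈ S

/-- The set `G` generates the whole algebra. -/
def Generates {α : Type u} [InteriorAlgebra α] (G : Set α) : Prop :=
  ∀ S : Set α, IsSubuniverse S → G ⊆ S → S = Set.univ

/-- `b` is the opremum of the Heyting algebra of open elements: the greatest element among the
open elements different from `⊤`. -/
def IsOpremum {α : Type u} [InteriorAlgebra α] (b : α) : Prop :=
  IsGreatest {a : α | box a = a ∧ a ≠ ⊤} b

/-! ### Modal formulas, validity, varieties -/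

/-- Modal formulas in the signature `∧, ∨, →, ¬, □`, with variables `p₀, p₁, …`. -/
inductive Formula : Type
  | var : ℕ → Formula
  | and : Formula → Formula → Formula
  | or : Formula → Formula → Formula
  | imp : Formula → Formula → Formula
  | neg : Formula → Formula
  | box : Formula → Formula

namespace Formula

/-- The set of variables that occur in a formula. -/
def vars : Formula → Finset ℕ
  | var i => {i}
  | and φ ψ => φ.vars ∪ ψ.vars
  | or φ ψ => φ.vars ∪ ψ.vars
  | imp φ ψ => φ.vars ∪ ψ.vars
  | neg φ => φ.vars
  | box φ => φ.vars

/-- The value of a formula under a valuation. -/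
def eval {α : Type u} [InteriorAlgebra α] (ν : ℕ → α) : Formula → α
  | var i => ν i
  | and φ ψ => φ.eval ν ⊓ ψ.eval ν
  | or φ ψ => φ.eval ν ⊔ ψ.eval ν
  | imp φ ψ => φ.eval ν ⇨ ψ.eval ν
  | neg φ => (φ.eval ν)ᶜ
  | box φ => InteriorAlgebra.box (φ.eval ν)

/-- `φ ↔ ψ`. -/
def iff (φ ψ : Formula) : Formula := and (imp φ ψ) (imp ψ φ)

/-- The implication `□φ → □ψ`. -/
def boxImp (φ ψ : Formula) : Formula := imp (box φ) (box ψ)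

/-- The conjunction of a list of formulas (a tautology if the list is empty). -/
def conj : List Formula → Formula
  | [] => imp (var 0) (var 0)
  | [φ] => φ
  | φ :: ψ :: l => and φ (conj (ψ :: l))

end Formula

/-- `𝔄 ⊨ φ`. -/
def Valid (𝔄 : Alg.{u}) (φ : Formula) : Prop := ∀ ν : ℕ → 𝔄, φ.eval ν = ⊤

/-- The class of all interior algebras in which all formulas of `Γ` are valid. -/
def Mod (Γ : Set Formula) : Set Alg.{u} := {𝔄 | ∀ φ ∈ Γ, Valid 𝔄 φ}

/-- Varieties of interior algebras, as equational classes; an equation `φ = ψ` amounts to the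
validity of the formula `φ ↔ ψ`, and the validity of `φ` to the equation `φ = (φ → φ)`. -/
def IsVariety (M : Set Alg.{u}) : Prop := ∃ Γ : Set Formula, M = Mod Γ

/-! ### Finite presentations and characteristic formulas -/

/-- The pair `(φ, ν)` defines the algebra `𝔄` over `M`, in the finitely many variables of `P`. -/
structure Defines (M : Set Alg.{u}) (𝔄 : Alg.{u}) (P : Finset ℕ) (φ : Formula) (ν : ℕ → 𝔄) :
    Prop where
  vars_subset : φ.vars ⊆ P
  generates : Generates (ν '' (P : Set ℕ))
  eval_eq_top : φ.eval ν = ⊤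
  derives : ∀ ψ : Formula, ψ.vars ⊆ P → ψ.eval ν = ⊤ → ∀ 𝔅 ∈ M, Valid 𝔅 (φ.boxImp ψ)

/-- `χ` is a characteristic formula over `M` of the algebra `𝔄`, a subdirectly irreducible member
of `M` that is finitely presentable over `M`. -/
def IsCharacteristicFormula (M : Set Alg.{u}) (𝔄 : Alg.{u}) (χ : Formula) : Prop :=
  𝔄 ∈ M ∧ IsSubdirectlyIrreducible 𝔄 ∧
    ∃ (P : Finset ℕ) (φ ψ : Formula) (ν : ℕ → 𝔄),
      Defines M 𝔄 P φ ν ∧ ψ.vars ⊆ P ∧ IsOpremum (ψ.eval ν) ∧ χ = φ.boxImp ψ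

/-! ### Jankov formulas -/

/-- The diagram formula of a finite interior algebra with the enumeration
`e 0, …, e (n - 1)` of its elements; the variable `pᵢ` stands for the element `e i`. -/
def diagram {α : Type u} [InteriorAlgebra α] {n : ℕ} (e : Fin n ≃ α) : Formula :=
  let p : α → Formula := fun a => .var (e.symm a)
  let elems : List α := (List.finRange n).map e
  .conj
    ((elems ×ˢ elems).map (fun x => .iff (.and (p x.1) (p x.2)) (p (x.1 ⊓ x.2))) ++
     (elems ×ˢ elems).map (fun x => .iff (.or (p x.1) (p x.2)) (p (x.1 ⊔ x.2))) ++
     (elems ×ˢ elems).map (fun x => .iff (.imp (p x.1) (p x.2)) (p (x.1 ⇨ x.2))) ++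
     elems.map (fun a => .iff (.neg (p a)) (p aᶜ)) ++
     elems.map (fun a => .iff (.box (p a)) (p (InteriorAlgebra.box a))))

/-- `χ` is a Jankov formula of the finite subdirectly irreducible interior algebra `𝔄`. -/
def IsJankovFormulaOf (𝔄 : Alg.{u}) (χ : Formula) : Prop :=
  IsSubdirectlyIrreducible 𝔄 ∧
    ∃ (n : ℕ) (e : Fin n ≃ 𝔄) (k : Fin n),
      IsOpremum (e k) ∧ χ = (diagram e).boxImp (Formula.var k)

/-- The class `V` is axiomatized by Jankov formulas of finite subdirectly irreducible algebras. -/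
def AxiomatizedByJankovFormulas (V : Set Alg.{u}) : Prop :=
  ∃ Γ : Set Formula, (∀ χ ∈ Γ, ∃ 𝔄 : Alg.{u}, IsJankovFormulaOf 𝔄 χ) ∧ V = Mod Γ

/-- The class `V` is defined by characteristic formulas, over `M`, of infinite algebras. -/
def DefinedByCharacteristicFormulas (M V : Set Alg.{u}) : Prop :=
  ∃ Γ : Set Formula,
    (∀ χ ∈ Γ, ∃ 𝔄 : Alg.{u}, Infinite 𝔄 ∧ IsCharacteristicFormula M 𝔄 χ) ∧ V = Mod Γ

end InteriorAlgebra

/-!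
A characteristic formula of an infinite algebra over `M` is valid in every finite member of `M`: a
refuting valuation would induce an embedding of that infinite algebra into a quotient of the finite
one. A Jankov formula that is refuted in a member of `M`, on the other hand, is the Jankov formula
of a finite member of `M`, where it fails. Hence a variety defined by a nonempty set of
characteristic formulas, over `M`, of infinite algebras is never axiomatized by Jankov formulas, and
it suffices to find infinitely many infinite algebras over `M` each of which refutes its own
characteristic formula and validates those of the others.

These algebras live on Kripke frames that are infinite ladders with one additional world, the twin,
at a height that depends on `n`, and a root. The rungs are definable from the lowest one. If the
formula that describes the `n`-th ladder holds at all worlds above a given world of any ladder, then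
this world is bisimilar to a world of the `n`-th ladder, so this formula presents the `n`-th ladder
algebra over the variety that the ladders generate; and only in the `n`-th ladder can that world
look like the root, because two worlds share the height `n + 4` only there.
-/

namespace InteriorAlgebra

section Congruences

variable {α β : Type*} [InteriorAlgebra α] [InteriorAlgebra β]

theorem box_mono {a b : α} (h : a ≤ b) : box a ≤ box b := by
  rw [← inf_eq_left, ← box_inf, inf_eq_left.2 h]

theorem box_box (a : α) : box (box a) = box a :=
  le_antisymm (box_le _) (box_le_box_box a)

theorem box_le_box_iff {a b : α} : box a ≤ box b ↔ box a ≤ b :=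
  ⟨fun h => h.trans (box_le b), fun h => box_box a ▸ box_mono h⟩

/-- Agreement of elements below `c`. For open `c` this is the congruence that corresponds to the
open filter generated by `c`. -/
def agreeBelow (c : α) : Setoid α := Setoid.ker (c ⊓ ·)

theorem agreeBelow_iff {a b c : α} : agreeBelow c a b ↔ c ⊓ a = c ⊓ b := Iff.rfl

theorem agreeBelow_top_iff {a c : α} : agreeBelow c a ⊤ ↔ c ≤ a := by
  rw [agreeBelow_iff, inf_top_eq, inf_eq_left]

theorem isCongruence_agreeBelow {c : α} (hc : box c = c) : IsCongruence (agreeBelow c) := by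
  have compl_congr {a b : α} (h : c ⊓ a = c ⊓ b) : c ⊓ aᶜ = c ⊓ bᶜ := by
    have inf_compl_inf (x : α) : c ⊓ (c ⊓ x)ᶜ = c ⊓ xᶜ := by simp [compl_inf, inf_sup_left]
    rw [← inf_compl_inf a, h, inf_compl_inf]
  have sup_congr {a b a' b' : α} (h : c ⊓ a = c ⊓ b) (h' : c ⊓ a' = c ⊓ b') :
      c ⊓ (a ⊔ a') = c ⊓ (b ⊔ b') := by
    rw [inf_sup_left, h, h', ← inf_sup_left]
  constructor <;> simp only [agreeBelow_iff]
  · intro a b a' b' h h'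
    rw [inf_inf_distrib_left, h, h', ← inf_inf_distrib_left]
  · exact fun _ _ _ _ => sup_congr
  · intro a b a' b' h h'
    rw [himp_eq, himp_eq, sup_congr h' (compl_congr h)]
  · exact fun _ _ => compl_congr
  · intro a b h
    rw [← hc, ← box_inf, h, box_inf]

theorem isCongruence_bot : IsCongruence (⊥ : Setoid α) where
  inf _ _ _ _ := congrArg₂ (· ⊓ ·)
  sup _ _ _ _ := congrArg₂ (· ⊔ ·)
  himp _ _ _ _ := congrArg₂ (· ⇨ ·)
  compl _ _ := congrArg compl
  box _ _ := congrArg box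

namespace IsCongruence

variable {θ : Setoid α}

theorem agreeBelow_le (hθ : IsCongruence θ) {c : α} (hc : θ c ⊤) : agreeBelow c ≤ θ := by
  have rel_inf (a : α) : θ (c ⊓ a) a := by simpa using hθ.inf _ _ _ _ hc (θ.refl a)
  intro a b (h : c ⊓ a = c ⊓ b)
  exact θ.trans (θ.symm (rel_inf a)) (h ▸ rel_inf b)

theorem opremum_rel_top (hθ : IsCongruence θ) (hne : θ ≠ ⊥) {b : α} (hb : IsOpremum b) :
    θ b ⊤ := by
  obtain ⟨x, y, hxy, hxy_ne⟩ : ∃ x y, θ x y ∧ x ≠ y := by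
    by_contra! h
    exact hne (le_bot_iff.1 fun x y => h x y)
  have box_rel_top : θ (InteriorAlgebra.box (bihimp x y)) ⊤ := by
    have h := hθ.inf _ _ _ _ (hθ.himp _ _ _ _ (θ.refl y) hxy) (hθ.himp _ _ _ _ hxy (θ.refl y))
    simpa [bihimp, box_top] using hθ.box _ _ h
  have box_le_opremum : InteriorAlgebra.box (bihimp x y) ≤ b := by
    refine hb.2 ⟨box_box _, fun h => hxy_ne (bihimp_eq_top.1 ?_)⟩
    exact top_le_iff.1 (h ▸ box_le _)
  simpa [box_le_opremum] using hθ.sup _ _ _ _ box_rel_top (θ.refl b)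

end IsCongruence

theorem IsOpremum.isSubdirectlyIrreducible {b : α} (hb : IsOpremum b) :
    IsSubdirectlyIrreducible α := by
  refine ⟨agreeBelow b, isCongruence_agreeBelow hb.1.1, fun h => hb.1.2 ?_, fun θ hθ hne =>
    hθ.agreeBelow_le (hθ.opremum_rel_top hne hb)⟩
  have : agreeBelow b b ⊤ := agreeBelow_top_iff.2 le_rfl
  rwa [h] at this

/-- The map `f` preserves the operations up to `θ`; if `θ` is a congruence, then `f` induces a
homomorphism to the quotient by `θ`. -/
structure IsHomModulo (θ : Setoid α) (f : β → α) : Prop where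
  inf : ∀ a b, θ (f a ⊓ f b) (f (a ⊓ b))
  sup : ∀ a b, θ (f a ⊔ f b) (f (a ⊔ b))
  himp : ∀ a b, θ (f a ⇨ f b) (f (a ⇨ b))
  compl : ∀ a, θ (f a)ᶜ (f aᶜ)
  box : ∀ a, θ (box (f a)) (f (box a))

namespace IsHomModulo

variable {θ : Setoid α} {f : β → α}

theorem rel_eval (hf : IsHomModulo θ f) (hθ : IsCongruence θ) (ν : ℕ → β) (φ : Formula) :
    θ (φ.eval fun i => f (ν i)) (f (φ.eval ν)) := by
  induction φ with
  | var i => exact θ.refl _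
  | and φ ψ hφ hψ => exact θ.trans (hθ.inf _ _ _ _ hφ hψ) (hf.inf _ _)
  | or φ ψ hφ hψ => exact θ.trans (hθ.sup _ _ _ _ hφ hψ) (hf.sup _ _)
  | imp φ ψ hφ hψ => exact θ.trans (hθ.himp _ _ _ _ hφ hψ) (hf.himp _ _)
  | neg φ hφ => exact θ.trans (hθ.compl _ _ hφ) (hf.compl _)
  | box φ hφ => exact θ.trans (hθ.box _ _ hφ) (hf.box _)

theorem top_rel (hf : IsHomModulo θ f) : θ ⊤ (f ⊤) := by simpa using hf.himp ⊤ ⊤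

theorem isCongruence_comap (hf : IsHomModulo θ f) (hθ : IsCongruence θ) :
    IsCongruence (θ.comap f) where
  inf _ _ _ _ h h' := θ.trans (θ.symm (hf.inf _ _)) (θ.trans (hθ.inf _ _ _ _ h h') (hf.inf _ _))
  sup _ _ _ _ h h' := θ.trans (θ.symm (hf.sup _ _)) (θ.trans (hθ.sup _ _ _ _ h h') (hf.sup _ _))
  himp _ _ _ _ h h' :=
    θ.trans (θ.symm (hf.himp _ _)) (θ.trans (hθ.himp _ _ _ _ h h') (hf.himp _ _))
  compl _ _ h := θ.trans (θ.symm (hf.compl _)) (θ.trans (hθ.compl _ _ h) (hf.compl _))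
  box _ _ h := θ.trans (θ.symm (hf.box _)) (θ.trans (hθ.box _ _ h) (hf.box _))

theorem comap_eq_bot (hf : IsHomModulo θ f) (hθ : IsCongruence θ) {b : β} (hb : IsOpremum b)
    (hfb : ¬ θ (f b) ⊤) : θ.comap f = ⊥ := by
  by_contra hne
  exact hfb (θ.trans ((hf.isCongruence_comap hθ).opremum_rel_top hne hb) (θ.symm hf.top_rel))

end IsHomModulo

end Congruences

section Evaluation

variable {α : Type*} [InteriorAlgebra α] {ν : ℕ → α}

theorem eval_boxImp_eq_top {φ ψ : Formula} :
    (φ.boxImp ψ).eval ν = ⊤ ↔ box (φ.eval ν) ≤ ψ.eval ν :=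
  himp_eq_top_iff.trans box_le_box_iff

theorem le_eval_iff_iff {φ ψ : Formula} {c : α} :
    c ≤ (φ.iff ψ).eval ν ↔ agreeBelow c (φ.eval ν) (ψ.eval ν) := by
  simp only [Formula.iff, Formula.eval, le_inf_iff, le_himp_iff, agreeBelow_iff]
  constructor
  · rintro ⟨h, h'⟩
    exact le_antisymm (le_inf inf_le_left h) (le_inf inf_le_left h')
  · intro h
    exact ⟨h ▸ inf_le_right, h ▸ inf_le_right⟩

theorem le_eval_conj_iff {c : α} :
    ∀ {l : List Formula}, c ≤ (Formula.conj l).eval ν ↔ ∀ φ ∈ l, c ≤ φ.eval ν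
  | [] => by simp [Formula.conj, Formula.eval]
  | [φ] => by simp [Formula.conj]
  | φ :: ψ :: l => by
    simp only [Formula.conj, Formula.eval, le_inf_iff, le_eval_conj_iff (l := ψ :: l),
      List.forall_mem_cons]

end Evaluation

section Subalgebras

variable {α : Type*} [InteriorAlgebra α]

theorem IsSubuniverse.eval_mem {S : Set α} (hS : IsSubuniverse S) {P : Finset ℕ} {ν : ℕ → α}
    (hν : ∀ i ∈ P, ν i ∈ S) {φ : Formula} (hφ : φ.vars ⊆ P) : φ.eval ν ∈ S := by
  induction φ with
  | var i => exact hν i (Finset.singleton_subset_iff.1 hφ)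
  | and φ ψ ihφ ihψ =>
    exact hS.inf _ (ihφ (Finset.union_subset_left hφ)) _ (ihψ (Finset.union_subset_right hφ))
  | or φ ψ ihφ ihψ =>
    exact hS.sup _ (ihφ (Finset.union_subset_left hφ)) _ (ihψ (Finset.union_subset_right hφ))
  | imp φ ψ ihφ ihψ =>
    exact hS.himp _ (ihφ (Finset.union_subset_left hφ)) _ (ihψ (Finset.union_subset_right hφ))
  | neg φ ih => exact hS.compl _ (ih hφ)
  | box φ ih => exact hS.box _ (ih hφ)

/-- The set of values of the formulas in the variables of `P` under `ν`, that is, the subuniverse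
generated by the values of these variables. -/
def definable (ν : ℕ → α) (P : Finset ℕ) : Set α := {a | ∃ φ : Formula, φ.vars ⊆ P ∧ φ.eval ν = a}

theorem mem_definable {ν : ℕ → α} {P : Finset ℕ} {i : ℕ} (hi : i ∈ P) : ν i ∈ definable ν P :=
  ⟨.var i, Finset.singleton_subset_iff.2 hi, rfl⟩

theorem isSubuniverse_definable (ν : ℕ → α) (P : Finset ℕ) : IsSubuniverse (definable ν P) where
  inf := by
    rintro _ ⟨φ, hφ, rfl⟩ _ ⟨ψ, hψ, rfl⟩
    exact ⟨.and φ ψ, Finset.union_subset hφ hψ, rfl⟩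
  sup := by
    rintro _ ⟨φ, hφ, rfl⟩ _ ⟨ψ, hψ, rfl⟩
    exact ⟨.or φ ψ, Finset.union_subset hφ hψ, rfl⟩
  himp := by
    rintro _ ⟨φ, hφ, rfl⟩ _ ⟨ψ, hψ, rfl⟩
    exact ⟨.imp φ ψ, Finset.union_subset hφ hψ, rfl⟩
  compl := by
    rintro _ ⟨φ, hφ, rfl⟩
    exact ⟨.neg φ, hφ, rfl⟩
  box := by
    rintro _ ⟨φ, hφ, rfl⟩
    exact ⟨.box φ, hφ, rfl⟩

theorem Generates.definable_eq_univ {P : Finset ℕ} {ν : ℕ → α}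
    (h : Generates (ν '' (P : Set ℕ))) : definable ν P = Set.univ :=
  h _ (isSubuniverse_definable ν P) (Set.image_subset_iff.2 fun _ => mem_definable)

namespace IsSubuniverse

variable {S : Set α} (hS : IsSubuniverse S) (hne : S.Nonempty)

/-- A nonempty subuniverse as a subalgebra of the Boolean reduct. -/
def booleanSubalgebra : BooleanSubalgebra α where
  carrier := S
  supClosed' _ ha _ hb := hS.sup _ ha _ hb
  infClosed' _ ha _ hb := hS.inf _ ha _ hb
  compl_mem' ha := hS.compl _ ha
  bot_mem' := by
    obtain ⟨a, ha⟩ := hne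
    exact inf_compl_eq_bot (a := a) ▸ hS.inf _ ha _ (hS.compl _ ha)

/-- A nonempty subuniverse as an interior algebra. -/
def toAlg : Alg where
  carrier := hS.booleanSubalgebra hne
  str :=
    { (inferInstance : BooleanAlgebra (hS.booleanSubalgebra hne)) with
      box := fun a => ⟨InteriorAlgebra.box a.1, hS.box _ a.2⟩
      box_top := Subtype.ext box_top
      box_inf := fun a b => Subtype.ext (box_inf a.1 b.1)
      box_le := fun a => box_le a.1
      box_le_box_box := fun a => box_le_box_box a.1 }

theorem coe_eval (ν : ℕ → hS.toAlg hne) (φ : Formula) :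
    (φ.eval ν).1 = φ.eval fun i => (ν i).1 :=
  have : IsHomModulo (⊥ : Setoid α) (fun a : hS.toAlg hne => a.1) :=
    ⟨fun _ _ => rfl, fun _ _ => rfl, fun _ _ => rfl, fun _ => rfl, fun _ => rfl⟩
  (this.rel_eval isCongruence_bot ν φ).symm

end IsSubuniverse

theorem Valid.toAlg {𝔅 : Alg} {φ : Formula} (h : Valid 𝔅 φ) {S : Set 𝔅} (hS : IsSubuniverse S)
    (hne : S.Nonempty) : Valid (hS.toAlg hne) φ := fun ν =>
  Subtype.ext ((hS.coe_eval hne ν φ).trans (h _))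

theorem generates_of_coe_eq {ν : ℕ → α} {P : Finset ℕ} (hne : (definable ν P).Nonempty)
    {ν' : ℕ → (isSubuniverse_definable ν P).toAlg hne} (hν' : ∀ i, (ν' i).1 = ν i) :
    Generates (ν' '' (P : Set ℕ)) := by
  refine fun T hT hPT => Set.eq_univ_of_forall fun a => ?_
  obtain ⟨φ, hφ, hφa⟩ := a.2
  have eval_eq : φ.eval ν' = a := by
    refine Subtype.ext ?_
    rw [IsSubuniverse.coe_eval, funext hν', hφa]
  exact eval_eq ▸ hT.eval_mem (fun i hi => hPT ⟨i, hi, rfl⟩) hφ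

end Subalgebras

/-! ### Characteristic formulas and Jankov formulas -/

section CharacteristicFormulas

variable {M : Set Alg.{u}} {𝔄 𝔅 : Alg.{u}} {P : Finset ℕ} {φ χ : Formula} {ν : ℕ → 𝔄}

theorem Defines.agreeBelow_eval (h : Defines M 𝔄 P φ ν) (h𝔅 : 𝔅 ∈ M) (w : ℕ → 𝔅)
    {ψ ψ' : Formula} (hψ : ψ.vars ⊆ P) (hψ' : ψ'.vars ⊆ P) (heq : ψ.eval ν = ψ'.eval ν) :
    agreeBelow (box (φ.eval w)) (ψ.eval w) (ψ'.eval w) := by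
  refine le_eval_iff_iff.1 (eval_boxImp_eq_top.1 (h.derives _ ?_ ?_ 𝔅 h𝔅 w))
  · simp [Formula.iff, Formula.vars, Finset.union_subset_iff, hψ, hψ']
  · exact top_le_iff.1 (le_eval_iff_iff.2 (heq ▸ (agreeBelow _).refl _))

/-- Von Dyck's theorem: a valuation in a member of `M` induces a homomorphism from the algebra that
`φ` presents, modulo the congruence that makes `φ` true. -/
theorem Defines.exists_isHomModulo (h : Defines M 𝔄 P φ ν) (h𝔅 : 𝔅 ∈ M) (w : ℕ → 𝔅) :
    ∃ f : 𝔄 → 𝔅, IsHomModulo (agreeBelow (box (φ.eval w))) f ∧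
      ∀ ψ : Formula, ψ.vars ⊆ P → agreeBelow (box (φ.eval w)) (ψ.eval w) (f (ψ.eval ν)) := by
  have exists_formula (a : 𝔄) : a ∈ definable ν P :=
    h.generates.definable_eq_univ ▸ Set.mem_univ a
  choose F hF hFν using exists_formula
  refine ⟨fun a => (F a).eval w, ⟨fun a b => ?_, fun a b => ?_, fun a b => ?_, fun a => ?_,
    fun a => ?_⟩, fun ψ hψ => h.agreeBelow_eval h𝔅 w hψ (hF _) (hFν _).symm⟩
  · exact h.agreeBelow_eval h𝔅 w (ψ := .and (F a) (F b)) (Finset.union_subset (hF a) (hF b))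
      (hF _) (by simp only [Formula.eval, hFν])
  · exact h.agreeBelow_eval h𝔅 w (ψ := .or (F a) (F b)) (Finset.union_subset (hF a) (hF b))
      (hF _) (by simp only [Formula.eval, hFν])
  · exact h.agreeBelow_eval h𝔅 w (ψ := .imp (F a) (F b)) (Finset.union_subset (hF a) (hF b))
      (hF _) (by simp only [Formula.eval, hFν])
  · exact h.agreeBelow_eval h𝔅 w (ψ := .neg (F a)) (hF a) (hF _) (by simp only [Formula.eval, hFν])
  · exact h.agreeBelow_eval h𝔅 w (ψ := .box (F a)) (hF a) (hF _) (by simp only [Formula.eval, hFν])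

theorem IsCharacteristicFormula.not_valid (h : IsCharacteristicFormula M 𝔄 χ) : ¬ Valid 𝔄 χ := by
  obtain ⟨-, -, P, φ, ψ, ν, hφ, -, hψ, rfl⟩ := h
  intro hv
  have h := eval_boxImp_eq_top.1 (hv ν)
  rw [hφ.eval_eq_top, box_top, top_le_iff] at h
  exact hψ.1.2 h

theorem IsCharacteristicFormula.valid_of_finite [Infinite 𝔄] [Finite 𝔅]
    (h : IsCharacteristicFormula M 𝔄 χ) (h𝔅 : 𝔅 ∈ M) : Valid 𝔅 χ := by
  obtain ⟨-, -, P, φ, ψ, ν, hφ, hψP, hψ, rfl⟩ := h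
  intro w
  obtain ⟨f, hf, hfw⟩ := hφ.exists_isHomModulo h𝔅 w
  rw [eval_boxImp_eq_top, ← agreeBelow_top_iff]
  by_contra hne
  have comap_eq_bot := hf.comap_eq_bot (isCongruence_agreeBelow (box_box _)) hψ fun h =>
    hne ((agreeBelow _).trans (hfw ψ hψP) h)
  have injective : Function.Injective fun a => box (φ.eval w) ⊓ f a := fun a b hab => by
    have : Setoid.comap f (agreeBelow (box (φ.eval w))) a b := hab
    rwa [comap_eq_bot] at this
  exact not_injective_infinite_finite _ injective

theorem le_eval_diagram_iff {α β : Type*} [InteriorAlgebra α] [InteriorAlgebra β] {n : ℕ}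
    {e : Fin n ≃ α} {w : ℕ → β} {c : β} :
    c ≤ (diagram e).eval w ↔ IsHomModulo (agreeBelow c) fun a => w (e.symm a) := by
  have mem_elems (a : α) : a ∈ (List.finRange n).map e :=
    List.mem_map.2 ⟨e.symm a, List.mem_finRange _, by simp⟩
  simp only [diagram, le_eval_conj_iff, List.forall_mem_append, List.forall_mem_map,
    List.mem_product, mem_elems, and_self, forall_const, Prod.forall, le_eval_iff_iff, Formula.eval,
    and_assoc]
  exact ⟨fun ⟨inf, sup, himp, compl, box⟩ => ⟨inf, sup, himp, compl, box⟩,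
    fun h => ⟨h.inf, h.sup, h.himp, h.compl, h.box⟩⟩

theorem IsJankovFormulaOf.not_valid (h : IsJankovFormulaOf 𝔄 χ) : ¬ Valid 𝔄 χ := by
  obtain ⟨-, n, e, k, hk, rfl⟩ := h
  intro hv
  let ν : ℕ → 𝔄 := fun i => if h : i < n then e ⟨i, h⟩ else ⊤
  have ν_symm (a : 𝔄) : ν (e.symm a) = a := by simp [ν]
  have eval_diagram : ⊤ ≤ (diagram e).eval ν := by
    rw [le_eval_diagram_iff]
    simp only [ν_symm]
    exact ⟨fun _ _ => (agreeBelow _).refl _, fun _ _ => (agreeBelow _).refl _,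
      fun _ _ => (agreeBelow _).refl _, fun _ => (agreeBelow _).refl _,
      fun _ => (agreeBelow _).refl _⟩
  have h := eval_boxImp_eq_top.1 (hv ν)
  rw [top_le_iff.1 eval_diagram, box_top, top_le_iff] at h
  exact hk.1.2 (by simpa [Formula.eval, ν] using h)

theorem IsJankovFormulaOf.valid_of_not_valid {θ : Formula} (h : IsJankovFormulaOf 𝔅 χ)
    (hχ : ¬ Valid 𝔄 χ) (hθ : Valid 𝔄 θ) : Valid 𝔅 θ := by
  obtain ⟨-, n, e, k, hk, rfl⟩ := h
  obtain ⟨w, hw⟩ := not_forall.1 hχ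
  rw [eval_boxImp_eq_top, ← agreeBelow_top_iff] at hw
  have hf := le_eval_diagram_iff.1 (box_le ((diagram e).eval w))
  have hc := isCongruence_agreeBelow (box_box ((diagram e).eval w))
  have comap_eq_bot := hf.comap_eq_bot hc hk (by simpa [Formula.eval] using hw)
  intro ν
  have rel_top := hf.rel_eval hc ν θ
  rw [hθ] at rel_top
  have comap_rel_top : Setoid.comap (fun b => w (e.symm b)) (agreeBelow _) (θ.eval ν) ⊤ :=
    (agreeBelow _).trans ((agreeBelow _).symm rel_top) hf.top_rel
  rwa [comap_eq_bot] at comap_rel_top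

theorem IsJankovFormulaOf.finite (h : IsJankovFormulaOf 𝔄 χ) : Finite 𝔄 :=
  let ⟨_, _, e, _⟩ := h
  Finite.of_equiv _ e

/-- If such a variety were axiomatized by Jankov formulas, then one of these would be refuted in an
infinite algebra of `M`, so its finite algebra would belong to `M` and hence, being finite, to the
variety itself, although it refutes its own Jankov formula. -/
theorem not_axiomatizedByJankovFormulas (hM : IsVariety M) {Γ : Set Formula} (hne : Γ.Nonempty)
    (hΓ : ∀ χ ∈ Γ, ∃ 𝔄 : Alg.{u}, Infinite 𝔄 ∧ IsCharacteristicFormula M 𝔄 χ) :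
    ¬ AxiomatizedByJankovFormulas (Mod.{u} Γ) := by
  rintro ⟨Δ, hΔ, hmod⟩
  obtain ⟨Θ, rfl⟩ := hM
  obtain ⟨χ, hχ⟩ := hne
  obtain ⟨𝔄, -, h𝔄⟩ := hΓ χ hχ
  have not_mem : 𝔄 ∉ Mod Δ := hmod ▸ fun h => h𝔄.not_valid (h χ hχ)
  obtain ⟨δ, hδ, h𝔄δ⟩ : ∃ δ ∈ Δ, ¬ Valid 𝔄 δ := by simpa [Mod] using not_mem
  obtain ⟨𝔅, h𝔅⟩ := hΔ δ hδ
  have := h𝔅.finite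
  have mem_Mod : 𝔅 ∈ Mod Θ := fun θ hθ => h𝔅.valid_of_not_valid h𝔄δ (h𝔄.1 θ hθ)
  have mem : 𝔅 ∈ Mod Γ := fun γ hγ =>
    let ⟨_, _, hγ𝔄⟩ := hΓ γ hγ
    hγ𝔄.valid_of_finite mem_Mod
  rw [hmod] at mem
  exact h𝔅.not_valid (mem δ hδ)

end CharacteristicFormulas

/-! ### Kripke semantics -/

section Kripke

variable {W W' : Type*} [Preorder W] [Preorder W']

/-- The formula `◇φ`, as an abbreviation of `¬□¬φ`. -/
def Formula.dia (φ : Formula) : Formula := .neg (.box (.neg φ))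

/-- Truth of a formula at a world of the preorder `W` under the valuation `V` (Kripke semantics). -/
def Formula.Sat (V : ℕ → Set W) : Formula → W → Prop
  | .var i, x => x ∈ V i
  | .and φ ψ, x => φ.Sat V x ∧ ψ.Sat V x
  | .or φ ψ, x => φ.Sat V x ∨ ψ.Sat V x
  | .imp φ ψ, x => φ.Sat V x → ψ.Sat V x
  | .neg φ, x => ¬ φ.Sat V x
  | .box φ, x => ∀ y, x ≤ y → φ.Sat V y

theorem sat_dia {V : ℕ → Set W} {φ : Formula} {x : W} :
    φ.dia.Sat V x ↔ ∃ y, x ≤ y ∧ φ.Sat V y := by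
  simp [Formula.dia, Formula.Sat]

/-- The interior algebra of all subsets of a preorder, where `□S` is the largest upper set contained
in `S`. -/
def complexAlgebra (W : Type u) [Preorder W] : Alg.{u} where
  carrier := Set W
  str :=
    { (inferInstance : BooleanAlgebra (Set W)) with
      box := fun S => {x | ∀ y, x ≤ y → y ∈ S}
      box_top := Set.eq_univ_of_forall fun _ _ _ => trivial
      box_inf := fun _ _ => Set.ext fun _ => forall₂_and
      box_le := fun _ x hx => hx x le_rfl
      box_le_box_box := fun _ _ hx _ hxy _ hyz => hx _ (hxy.trans hyz) }

theorem eval_complexAlgebra {W : Type u} [Preorder W] (V : ℕ → complexAlgebra W) (φ : Formula) :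
    φ.eval V = {x | φ.Sat V x} := by
  induction φ with
  | var i => rfl
  | and φ ψ hφ hψ => exact congrArg₂ (· ⊓ ·) hφ hψ
  | or φ ψ hφ hψ => exact congrArg₂ (· ⊔ ·) hφ hψ
  | imp φ ψ hφ hψ => exact congrArg₂ (· ⇨ ·) hφ hψ
  | neg φ hφ => exact congrArg compl hφ
  | box φ hφ => exact congrArg box hφ

theorem valid_complexAlgebra {W : Type u} [Preorder W] {φ : Formula} :
    Valid (complexAlgebra W) φ ↔ ∀ (V : ℕ → Set W) (x : W), φ.Sat V x := by
  refine forall_congr' fun V => ?_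
  rw [eval_complexAlgebra]
  exact Set.eq_univ_iff_forall

/-- Bisimulations between Kripke models, with respect to the variables in `P`. -/
structure IsBisimulation (P : Finset ℕ) (V : ℕ → Set W) (V' : ℕ → Set W') (B : W → W' → Prop) :
    Prop where
  atom : ∀ {x y}, B x y → ∀ i ∈ P, x ∈ V i ↔ y ∈ V' i
  forth : ∀ {x y}, B x y → ∀ z, x ≤ z → ∃ t, y ≤ t ∧ B z t
  back : ∀ {x y}, B x y → ∀ t, y ≤ t → ∃ z, x ≤ z ∧ B z t

/-- Two worlds are bisimilar if they are related by a bisimulation. -/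
def Bisimilar (P : Finset ℕ) (V : ℕ → Set W) (V' : ℕ → Set W') (x : W) (y : W') : Prop :=
  ∃ B, IsBisimulation P V V' B ∧ B x y

variable {P : Finset ℕ} {V : ℕ → Set W} {V' : ℕ → Set W'} {x : W} {y : W'}

theorem isBisimulation_bisimilar (P : Finset ℕ) (V : ℕ → Set W) (V' : ℕ → Set W') :
    IsBisimulation P V V' (Bisimilar P V V') where
  atom := fun ⟨_, hB, hxy⟩ => hB.atom hxy
  forth := fun ⟨B, hB, hxy⟩ z hz =>
    let ⟨t, ht, hzt⟩ := hB.forth hxy z hz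
    ⟨t, ht, B, hB, hzt⟩
  back := fun ⟨B, hB, hxy⟩ t ht =>
    let ⟨z, hz, hzt⟩ := hB.back hxy t ht
    ⟨z, hz, B, hB, hzt⟩

namespace Bisimilar

theorem mem_iff (h : Bisimilar P V V' x y) {i : ℕ} (hi : i ∈ P) : x ∈ V i ↔ y ∈ V' i :=
  (isBisimulation_bisimilar P V V').atom h i hi

theorem forth (h : Bisimilar P V V' x y) {z : W} (hz : x ≤ z) :
    ∃ t, y ≤ t ∧ Bisimilar P V V' z t :=
  (isBisimulation_bisimilar P V V').forth h z hz

theorem back (h : Bisimilar P V V' x y) {t : W'} (ht : y ≤ t) :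
    ∃ z, x ≤ z ∧ Bisimilar P V V' z t :=
  (isBisimulation_bisimilar P V V').back h t ht

theorem sat_iff (h : Bisimilar P V V' x y) {φ : Formula} (hφ : φ.vars ⊆ P) :
    φ.Sat V x ↔ φ.Sat V' y := by
  induction φ generalizing x y with
  | var i => exact h.mem_iff (Finset.singleton_subset_iff.1 hφ)
  | and φ ψ ihφ ihψ =>
    exact and_congr (ihφ h (Finset.union_subset_left hφ)) (ihψ h (Finset.union_subset_right hφ))
  | or φ ψ ihφ ihψ =>
    exact or_congr (ihφ h (Finset.union_subset_left hφ)) (ihψ h (Finset.union_subset_right hφ))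
  | imp φ ψ ihφ ihψ =>
    exact imp_congr (ihφ h (Finset.union_subset_left hφ)) (ihψ h (Finset.union_subset_right hφ))
  | neg φ ih => exact not_congr (ih h hφ)
  | box φ ih =>
    constructor
    · intro hx t ht
      obtain ⟨z, hz, hzt⟩ := h.back ht
      exact (ih hzt hφ).1 (hx z hz)
    · intro hy z hz
      obtain ⟨t, ht, hzt⟩ := h.forth hz
      exact (ih hzt hφ).2 (hy t ht)

theorem of_forall_ne (atom : ∀ i ∈ P, x ∈ V i ↔ y ∈ V' i)
    (forth : ∀ z, x ≤ z → z ≠ x → ∃ t, y ≤ t ∧ Bisimilar P V V' z t)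
    (back : ∀ t, y ≤ t → t ≠ y → ∃ z, x ≤ z ∧ Bisimilar P V V' z t) :
    Bisimilar P V V' x y := by
  refine ⟨fun z t => Bisimilar P V V' z t ∨ (z = x ∧ t = y), ⟨?_, ?_, ?_⟩, .inr ⟨rfl, rfl⟩⟩
  · rintro z t (h | ⟨rfl, rfl⟩)
    exacts [fun i => h.mem_iff, atom]
  · rintro z t (h | ⟨rfl, rfl⟩) z' hz'
    · obtain ⟨t', ht', h'⟩ := h.forth hz'
      exact ⟨t', ht', .inl h'⟩
    · obtain rfl | hne := eq_or_ne z' z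
      · exact ⟨t, le_rfl, .inr ⟨rfl, rfl⟩⟩
      · obtain ⟨t', ht', h'⟩ := forth z' hz' hne
        exact ⟨t', ht', .inl h'⟩
  · rintro z t (h | ⟨rfl, rfl⟩) t' ht'
    · obtain ⟨z', hz', h'⟩ := h.back ht'
      exact ⟨z', hz', .inl h'⟩
    · obtain rfl | hne := eq_or_ne t' t
      · exact ⟨z, le_rfl, .inr ⟨rfl, rfl⟩⟩
      · obtain ⟨z', hz', h'⟩ := back t' ht' hne
        exact ⟨z', hz', .inl h'⟩

end Bisimilar

end Kripke

/-! ### Ladders -/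

/-- The worlds of the `n`-th ladder, a Kripke frame that consists of infinitely many rungs, of which
`rung ⊤` is the limit, of a world `twin` that sees the same rungs as `rung (n + 4)`, and of a
root. -/
inductive Ladder (n : ℕ) : Type u
  | rung : ℕ∞ → Ladder n
  | twin : Ladder n
  | root : Ladder n

namespace Ladder

variable {n : ℕ}

/-- The number of the rung that sees the same rungs as the given world; the root is sent to `⊤`. -/
def height : Ladder n → ℕ∞
  | rung k => k
  | twin => n + 4
  | root => ⊤

instance : PartialOrder (Ladder n) where
  le x y := x = root ∨ x = y ∨ ∃ k, y = rung k ∧ k + 2 ≤ x.height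
  le_refl _ := .inr (.inl rfl)
  le_trans := by
    rintro x y z (h | rfl | ⟨k, rfl, hk⟩) hyz
    · exact .inl h
    · exact hyz
    · obtain h | rfl | ⟨l, rfl, hl⟩ := hyz
      · cases h
      · exact .inr (.inr ⟨k, rfl, hk⟩)
      · exact .inr (.inr ⟨l, rfl, hl.trans (le_self_add.trans hk)⟩)
  le_antisymm := by
    rintro x y (rfl | rfl | ⟨k, rfl, hk⟩) (hy | hyx | ⟨l, hl', hl⟩)
    any_goals first | rfl | exact hy.symm | exact hyx.symm | contradiction
    subst hl'
    simp only [height] at hk hl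
    enat_to_nat
    grind

theorem le_iff {x y : Ladder n} :
    x ≤ y ↔ x = root ∨ x = y ∨ ∃ k, y = rung k ∧ k + 2 ≤ x.height := Iff.rfl

theorem root_le (x : Ladder n) : root ≤ x := .inl rfl

theorem le_rung {x : Ladder n} {k : ℕ∞} (h : k + 2 ≤ x.height) : x ≤ rung k :=
  .inr (.inr ⟨k, rfl, h⟩)

theorem rung_le_rung_iff {j k : ℕ∞} :
    (rung j : Ladder n) ≤ rung k ↔ j = k ∨ k + 2 ≤ j := by
  simp [le_iff, height]

theorem twin_le_rung_iff {k : ℕ∞} : (twin : Ladder n) ≤ rung k ↔ k + 2 ≤ n + 4 := by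
  simp [le_iff, height]

theorem le_twin_iff {x : Ladder n} : x ≤ twin ↔ x = root ∨ x = twin := by
  simp [le_iff]

theorem height_add_two_le {x y : Ladder n} (h : x ≤ y) (hne : y ≠ x) :
    y.height + 2 ≤ x.height := by
  obtain rfl | rfl | ⟨k, rfl, hk⟩ := h
  · exact le_top
  · exact absurd rfl hne
  · exact hk

theorem height_eq_coe_iff {x : Ladder n} {k : ℕ} :
    x.height = k ↔ x = rung k ∨ k = n + 4 ∧ x = twin := by
  cases x with
  | rung j => simp [height]
  | twin => simpa [height, eq_comm] using ENat.natCast_inj (a := k) (b := n + 4)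
  | root => simp [height]

theorem le_rung_or_eq_rung (x : Ladder n) {k : ℕ} (hk : k ≤ 2) :
    x ≤ rung k ∨ ∃ j : ℕ, j ≤ k + 1 ∧ j ≠ k ∧ x = rung j := by
  by_cases h : (k : ℕ∞) + 2 ≤ x.height
  · exact .inl (le_rung h)
  · have height_ne_top : x.height ≠ ⊤ := fun h' => h (h' ▸ le_top)
    lift x.height to ℕ using height_ne_top with j hj
    have hjk : j ≤ k + 1 := by
      norm_cast at h
      omega
    obtain rfl | ⟨rfl, -⟩ := height_eq_coe_iff.1 hj.symm
    · obtain rfl | hne := eq_or_ne j k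
      · exact .inl le_rfl
      · exact .inr ⟨j, hjk, hne, rfl⟩
    · omega

theorem le_rung_zero_or_eq_rung_one (x : Ladder n) : x ≤ rung 0 ∨ x = rung 1 := by
  obtain h | ⟨j, hj, hj0, rfl⟩ := le_rung_or_eq_rung x (k := 0) (by simp)
  · exact .inl h
  · obtain rfl : j = 1 := by omega
    exact .inr rfl

theorem le_rung_one_or_eq_rung_zero_or_eq_rung_two (x : Ladder n) :
    x ≤ rung 1 ∨ x = rung 0 ∨ x = rung 2 := by
  obtain h | ⟨j, hj, hj1, rfl⟩ := le_rung_or_eq_rung x (k := 1) (by simp)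
  · exact .inl h
  · obtain rfl | rfl : j = 0 ∨ j = 2 := by omega
    exacts [.inr (.inl rfl), .inr (.inr rfl)]

theorem isMax_rung {k : ℕ∞} (hk : k < 2) : IsMax (rung k : Ladder n) := by
  intro y hy
  obtain h | rfl | ⟨j, -, hj⟩ := hy
  · cases h
  · exact le_rfl
  · exact absurd (le_add_self.trans hj) hk.not_ge

theorem height_eq_zero_iff {x : Ladder n} : x.height = 0 ↔ x = rung 0 := by
  simpa using height_eq_coe_iff (x := x) (k := 0)

theorem exists_ge_height_eq_iff {x : Ladder n} {k : ℕ} :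
    (∃ y, x ≤ y ∧ y.height = k) ↔ x.height = k ∨ (k : ℕ∞) + 2 ≤ x.height := by
  constructor
  · rintro ⟨y, hxy, hy⟩
    obtain rfl | hne := eq_or_ne y x
    · exact .inl hy
    · exact .inr (hy ▸ height_add_two_le hxy hne)
  · rintro (h | h)
    · exact ⟨x, le_rfl, h⟩
    · exact ⟨rung k, le_rung h, rfl⟩

instance : WellFoundedGT (Ladder n) := by
  let rank : Ladder n → WithTop ℕ∞
    | root => ⊤
    | x => x.height
  have rank_strictAnti : StrictAnti rank := by
    intro x y hxy
    obtain rfl | rfl | ⟨k, rfl, hk⟩ := hxy.le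
    · cases y with
      | root => exact absurd rfl hxy.ne
      | _ => exact WithTop.coe_lt_top _
    · exact absurd rfl hxy.ne
    · cases x with
      | root => exact WithTop.coe_lt_top _
      | rung j =>
        have hne : k ≠ j := by
          rintro rfl
          exact hxy.ne rfl
        exact WithTop.coe_lt_coe.2 ((le_self_add.trans hk).lt_of_ne hne)
      | twin =>
        refine WithTop.coe_lt_coe.2 ?_
        simp only [height] at hk ⊢
        enat_to_nat
        omega
  exact rank_strictAnti.wellFoundedGT

/-- The valuation that generates the ladder algebra: `p₀` holds at the lowest rung and `p₁` at the
twin. -/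
def val (n i : ℕ) : Set (Ladder n) := if i = 1 then {twin} else {rung 0}

end Ladder

namespace Formula

/-- The formula in `p₀` that defines the `k`-th rung (and the twin, if it has height `k`). -/
def rung : ℕ → Formula
  | 0 => .var 0
  | 1 => .box (.neg (.var 0))
  | k + 2 => .and (dia (rung k)) (.and (.neg (dia (rung (k + 1)))) (.neg (rung k)))

/-- The formula that says that the `k`-th rung is visible; the twin, even if it has height `k`, does
not count. -/
def diaRung (k : ℕ) : Formula := dia (.and (rung k) (.neg (.var 1)))

/-- The formula that defines the root, the only world that sees the twin without being it. -/
def root : Formula := .and (.neg (.var 1)) (dia (.var 1))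

/-- The formula that describes the worlds that the twin sees. -/
def twin (n : ℕ) : Formula :=
  .and (.neg (.var 0)) <| .and (.box (.imp (.neg (.var 1)) (.box (.neg (.var 1))))) <|
    .and (diaRung (n + 1)) <| .and (diaRung (n + 2)) <|
      .and (.neg (diaRung (n + 3))) (.neg (diaRung (n + 4)))

/-- The formula that defines the ladder algebra over the variety generated by all ladders. -/
def ladder (n : ℕ) : Formula :=
  .and (.imp (.var 0) (.box (.var 0))) <|
    .and (.imp (.var 1) (twin n)) (.imp root (diaRung (n + 4)))

theorem vars_rung_subset : ∀ k, (rung k).vars ⊆ {0, 1}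
  | 0 => by simp [rung, vars]
  | 1 => by simp [rung, vars]
  | k + 2 => by
    simp [rung, dia, vars, Finset.union_subset_iff, vars_rung_subset k, vars_rung_subset (k + 1)]

theorem vars_root_subset : root.vars ⊆ {0, 1} := by
  simp [root, dia, vars]

theorem vars_ladder_subset (n : ℕ) : (ladder n).vars ⊆ {0, 1} := by
  simp only [ladder, twin, diaRung, root, dia, vars, Finset.union_subset_iff, vars_rung_subset]
  simp

end Formula

namespace Ladder

variable {m n : ℕ}

theorem sat_rung {V : ℕ → Set (Ladder n)} {x : Ladder n}
    (hV : ∀ y, x ≤ y → (y ∈ V 0 ↔ y = rung 0)) :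
    ∀ (k : ℕ) {y : Ladder n}, x ≤ y → ((Formula.rung k).Sat V y ↔ y.height = k)
  | 0, y, hy => (hV y hy).trans height_eq_zero_iff.symm
  | 1, y, hy => by
    have sat_iff : (Formula.rung 1).Sat V y ↔ ¬ ∃ z, y ≤ z ∧ z.height = (0 : ℕ) := by
      push Not
      exact forall₂_congr fun z hz =>
        not_congr ((hV z (hy.trans hz)).trans height_eq_zero_iff.symm)
    rw [sat_iff, exists_ge_height_eq_iff]
    generalize y.height = h
    enat_to_nat <;> grind
  | k + 2, y, hy => by
    have sat_dia_iff (j : ℕ)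
        (ih : ∀ {z : Ladder n}, x ≤ z → ((Formula.rung j).Sat V z ↔ z.height = j)) :
        (Formula.rung j).dia.Sat V y ↔ y.height = j ∨ (j : ℕ∞) + 2 ≤ y.height := by
      rw [sat_dia, ← exists_ge_height_eq_iff]
      exact exists_congr fun z => and_congr_right fun hz => ih (hy.trans hz)
    have sat_iff : (Formula.rung (k + 2)).Sat V y ↔ (Formula.rung k).dia.Sat V y ∧
      ¬ (Formula.rung (k + 1)).dia.Sat V y ∧ ¬ (Formula.rung k).Sat V y := Iff.rfl
    rw [sat_iff, sat_dia_iff k (sat_rung hV k), sat_dia_iff (k + 1) (sat_rung hV (k + 1)),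
      sat_rung hV k hy]
    generalize y.height = h
    enat_to_nat <;> grind

theorem mem_val_zero {y : Ladder n} : y ∈ val n 0 ↔ y = rung 0 := by simp [val]

theorem mem_val_one {y : Ladder n} : y ∈ val n 1 ↔ y = twin := by simp [val]

theorem sat_rung_val {k : ℕ} {y : Ladder n} : (Formula.rung k).Sat (val n) y ↔ y.height = k :=
  sat_rung (fun _ _ => mem_val_zero) k le_rfl

theorem sat_root_val {y : Ladder n} : Formula.root.Sat (val n) y ↔ y = root := by
  have sat_iff : Formula.root.Sat (val n) y ↔ y ≠ twin ∧ y ≤ twin := by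
    simp [Formula.root, sat_dia, Formula.Sat, mem_val_one]
  rw [sat_iff, le_twin_iff]
  cases y <;> simp

theorem sat_diaRung_val {k : ℕ} {y : Ladder.{u} n} :
    (Formula.diaRung k).Sat (val n) y ↔ y ≤ rung k := by
  have height_eq_iff (z : Ladder.{u} n) : z.height = k ∧ ¬ z = twin ↔ z = rung k := by
    rw [height_eq_coe_iff]
    cases z <;> simp
  rw [Formula.diaRung, sat_dia]
  simp only [Formula.Sat, sat_rung_val, mem_val_one, height_eq_iff, exists_eq_right]

theorem sat_ladder_val (y : Ladder.{u} n) : (Formula.ladder n).Sat (val n) y := by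
  refine ⟨fun h z hz => ?_, fun h => ?_, fun h => sat_diaRung_val.2 (sat_root_val.1 h ▸ root_le _)⟩
  · obtain rfl := mem_val_zero.1 h
    obtain h | rfl | ⟨k, -, hk⟩ := hz
    · cases h
    · exact h
    · simp [height] at hk
  · obtain rfl := mem_val_one.1 h
    have persists (z t : Ladder.{u} n) (hz : twin ≤ z) (hz' : z ∉ val n 1) (ht : z ≤ t) :
        t ∉ val n 1 := fun h => by
      obtain rfl := mem_val_one.1 h
      exact hz' (mem_val_one.2 (le_antisymm ht hz))
    refine ⟨by simp [Formula.Sat, mem_val_zero], fun z hz hz' t ht => persists z t hz hz' ht, ?_⟩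
    simp only [Formula.Sat, sat_diaRung_val, twin_le_rung_iff]
    norm_cast
    omega

/-- If a world sees exactly the rungs of a set `S` closed under visibility, then it sees, apart from
itself, what the `i`-th rung sees. -/
theorem exists_rung_of_closed {S : Set ℕ∞} (hS : ∀ k ∈ S, ∀ j, j + 2 ≤ k → j ∈ S) :
    ∃ i : ℕ∞, i ≠ 0 ∧ (∀ k ∈ S, k = i ∨ k + 2 ≤ i) ∧ ∀ k, k + 2 ≤ i → k ≠ i → k ∈ S := by
  let U : Set ℕ∞ := {i | i ≠ 0 ∧ ∀ k ∈ S, k = i ∨ k + 2 ≤ i}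
  obtain ⟨i, hi, hmin⟩ := exists_minimal_of_wellFoundedLT (· ∈ U)
    ⟨⊤, by simp, fun k _ => .inr le_top⟩
  refine ⟨i, hi.1, hi.2, fun k hk hki => ?_⟩
  by_contra hkS
  have succ_mem : k + 1 ∈ U := by
    refine ⟨by simp, fun j hj => ?_⟩
    have hjk : ¬ k + 2 ≤ j := fun h => hkS (hS j hj k h)
    have hjk' : j ≠ k := fun h => hkS (h ▸ hj)
    enat_to_nat <;> grind
  have := hmin succ_mem
  enat_to_nat <;> grind

section LooksLike

variable {W : Type*} [PartialOrder W] {V : ℕ → Set W} {x : W}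

/-- The world `x` under the valuation `V` is bisimilar to the world `y` of the ladder. -/
abbrev LooksLike (V : ℕ → Set W) (x : W) (y : Ladder n) : Prop := Bisimilar {0, 1} V (val n) x y

theorem LooksLike.mem_zero_iff {y : Ladder n} (h : LooksLike V x y) : x ∈ V 0 ↔ y = rung 0 :=
  (h.mem_iff (by simp)).trans mem_val_zero

theorem LooksLike.mem_one_iff {y : Ladder n} (h : LooksLike V x y) : x ∈ V 1 ↔ y = twin :=
  (h.mem_iff (by simp)).trans mem_val_one

theorem LooksLike.sat_rung_iff {y : Ladder n} (h : LooksLike V x y) {k : ℕ} :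
    (Formula.rung k).Sat V x ↔ y.height = k :=
  (h.sat_iff (Formula.vars_rung_subset k)).trans sat_rung_val

theorem looksLike_of_forall_ne {y : Ladder n} (h0 : x ∈ V 0 ↔ y = rung 0)
    (h1 : x ∈ V 1 ↔ y = twin) (forth : ∀ z, x ≤ z → z ≠ x → ∃ t, y ≤ t ∧ LooksLike V z t)
    (back : ∀ t, y ≤ t → t ≠ y → ∃ z, x ≤ z ∧ LooksLike V z t) : LooksLike V x y :=
  Bisimilar.of_forall_ne (by simp [h0, h1, mem_val_zero, mem_val_one]) forth back

variable [WellFoundedGT W]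

theorem exists_looksLike_rung (n : ℕ) (hp : ∀ y, x ≤ y → y ∈ V 0 → ∀ z, y ≤ z → z ∈ V 0)
    (hq : ∀ y, x ≤ y → y ∉ V 1) : ∃ k, LooksLike V x (rung k : Ladder.{u} n) := by
  induction x using WellFoundedGT.induction with
  | ind x ih =>
    replace ih (z : W) (hz : x ≤ z) (hne : z ≠ x) : ∃ k, LooksLike V z (rung k : Ladder.{u} n) :=
      ih z (hz.lt_of_ne' hne) (fun y hy => hp y (hz.trans hy)) fun y hy => hq y (hz.trans hy)
    by_cases hx : x ∈ V 0
    · refine ⟨0, looksLike_of_forall_ne (by simpa) (by simp [hq x le_rfl]) (fun z hz hne => ?_)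
        fun t ht hne => ?_⟩
      · obtain ⟨k, hk⟩ := ih z hz hne
        exact ⟨rung k, (hk.mem_zero_iff.1 (hp x le_rfl hx z hz)).ge, hk⟩
      · simpa [height] using height_add_two_le ht hne
    · obtain ⟨i, hi0, hi, hi'⟩ := exists_rung_of_closed
        (S := {k | ∃ z, x ≤ z ∧ z ≠ x ∧ LooksLike V z (rung k : Ladder.{u} n)}) (by
          rintro k ⟨z, hz, hne, hzk⟩ j hjk
          obtain ⟨z', hz', hzj⟩ := hzk.back (le_rung hjk)
          exact ⟨z', hz.trans hz', fun h => hne (le_antisymm (h ▸ hz') hz), hzj⟩)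
      refine ⟨i, looksLike_of_forall_ne (by simp [hx, hi0]) (by simp [hq x le_rfl])
        (fun z hz hne => ?_) fun t ht hne => ?_⟩
      · obtain ⟨k, hk⟩ := ih z hz hne
        exact ⟨rung k, rung_le_rung_iff.2 ((hi k ⟨z, hz, hne, hk⟩).imp_left Eq.symm), hk⟩
      · obtain h | rfl | ⟨k, rfl, hk⟩ := ht
        · cases h
        · exact absurd rfl hne
        · obtain ⟨z, hz, -, hzk⟩ := hi' k hk fun h => hne (h ▸ rfl)
          exact ⟨z, hz, hzk⟩

theorem sat_diaRung_iff (n : ℕ) (hp : ∀ y, x ≤ y → y ∈ V 0 → ∀ z, y ≤ z → z ∈ V 0)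
    (hq : ∀ y, x ≤ y → y ∉ V 1 → ∀ z, y ≤ z → z ∉ V 1) {k : ℕ} :
    (Formula.diaRung k).Sat V x ↔ ∃ y, x ≤ y ∧ LooksLike V y (rung k : Ladder.{u} n) := by
  rw [Formula.diaRung, sat_dia]
  refine exists_congr fun y => and_congr_right fun hy => ⟨fun ⟨hyk, hyq⟩ => ?_, fun h => ?_⟩
  · obtain ⟨j, hj⟩ := exists_looksLike_rung.{u} n (fun z hz => hp z (hy.trans hz)) (hq y hy hyq)
    obtain rfl : j = k := hj.sat_rung_iff.1 hyk
    exact hj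
  · exact ⟨h.sat_rung_iff.2 rfl, by simp [Formula.Sat, h.mem_one_iff]⟩

theorem exists_looksLike_rung_iff (hp : ∀ y, x ≤ y → y ∈ V 0 → ∀ z, y ≤ z → z ∈ V 0)
    (h : (Formula.twin n).Sat V x) {k : ℕ∞} :
    (∃ y, x ≤ y ∧ LooksLike V y (rung k : Ladder.{u} n)) ↔ (twin : Ladder.{u} n) ≤ rung k := by
  obtain ⟨-, hq, hn1, hn2, hn3, hn4⟩ := h
  simp only [Formula.Sat, sat_diaRung_iff.{u} n hp hq] at hn1 hn2 hn3 hn4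
  have of_add_two_le {j k : ℕ∞} (hkj : k + 2 ≤ j) :
      (∃ y, x ≤ y ∧ LooksLike V y (rung j : Ladder.{u} n)) →
        ∃ y, x ≤ y ∧ LooksLike V y (rung k : Ladder.{u} n) := fun ⟨y, hy, hyj⟩ =>
    let ⟨z, hz, hzk⟩ := hyj.back (le_rung hkj)
    ⟨z, hy.trans hz, hzk⟩
  rw [twin_le_rung_iff]
  constructor
  · intro hk
    have hk3 : k ≠ (n + 3 : ℕ) := by rintro rfl; exact hn3 hk
    have hk4 : k ≠ (n + 4 : ℕ) := by rintro rfl; exact hn4 hk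
    have hk5 : ¬ ((n + 3 : ℕ) : ℕ∞) + 2 ≤ k := fun hle => hn3 (of_add_two_le hle hk)
    enat_to_nat <;> grind
  · intro hk
    have hk' : k = (n + 1 : ℕ) ∨ k = (n + 2 : ℕ) ∨ k + 2 ≤ (n + 2 : ℕ) := by
      enat_to_nat
      omega
    obtain rfl | rfl | hk' := hk'
    exacts [hn1, hn2, of_add_two_le hk' hn2]

theorem looksLike_twin (h : (Formula.ladder n).box.Sat V x) (hx : x ∈ V 1) :
    LooksLike V x (twin : Ladder.{u} n) := by
  induction x using WellFoundedGT.induction with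
  | ind x ih =>
    have hp (y : W) (hy : x ≤ y) := (h y hy).1
    have htwin := (h x le_rfl).2.1 hx
    have ⟨hx0, hq, _⟩ := htwin
    refine looksLike_of_forall_ne (by simpa [Formula.Sat] using hx0) (by simpa)
      (fun z hz hne => ?_) fun t ht hne => ?_
    · by_cases hzq : z ∈ V 1
      · exact ⟨twin, le_rfl, ih z (hz.lt_of_ne' hne) (fun y hy => h y (hz.trans hy)) hzq⟩
      · obtain ⟨k, hk⟩ := exists_looksLike_rung.{u} n (fun y hy => hp y (hz.trans hy)) (hq z hz hzq)
        exact ⟨rung k, (exists_looksLike_rung_iff hp htwin).1 ⟨z, hz, hk⟩, hk⟩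
    · obtain h | rfl | ⟨k, rfl, -⟩ := id ht
      · cases h
      · exact absurd rfl hne
      · exact (exists_looksLike_rung_iff hp htwin).2 ht

end LooksLike

section Root

variable {V : ℕ → Set (Ladder.{u} m)} {x : Ladder.{u} m}

theorem mem_zero_iff_eq_rung_zero (hp : ∀ y, x ≤ y → y ∈ V 0 → ∀ z, y ≤ z → z ∈ V 0)
    (h : ∀ k ≤ 2, ∃ y, x ≤ y ∧ (Formula.rung k).Sat V y) (y : Ladder.{u} m) (hy : x ≤ y) :
    y ∈ V 0 ↔ y = rung 0 := by
  -- `rung 2` tells the maximal worlds `rung 0` and `rung 1` apart, since it sees only the former.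
  obtain ⟨a, hxa, ha⟩ := h 0 (by simp)
  obtain ⟨b, hxb, hb⟩ := h 1 (by simp)
  obtain ⟨c, hxc, -, hc, hc0⟩ := h 2 le_rfl
  replace hp {y z : Ladder.{u} m} (hy : x ≤ y) (h : y ∈ V 0) (hz : y ≤ z) : z ∈ V 0 :=
    hp y hy h z hz
  replace hc {k : ℕ∞} (hk : k < 2) (hck : c ≤ rung k) : rung k ∈ V 0 := by
    by_contra hkV
    refine hc (sat_dia.2 ⟨rung k, hck, fun z hz => ?_⟩)
    rwa [← (isMax_rung hk).eq_of_le hz]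
  have rung_one_notMem : rung 1 ∉ V 0 := fun h1 => by
    have rung_zero_notMem : rung 0 ∉ V 0 := by
      obtain hb0 | rfl := le_rung_zero_or_eq_rung_one b
      exacts [hb _ hb0, absurd h1 (hb _ le_rfl)]
    obtain hc0' | rfl := le_rung_zero_or_eq_rung_one c
    exacts [rung_zero_notMem (hc (by simp) hc0'), hc0 h1]
  have rung_zero_mem : rung 0 ∈ V 0 := by
    obtain ha0 | rfl := le_rung_zero_or_eq_rung_one a
    exacts [hp hxa ha ha0, absurd ha rung_one_notMem]
  have rung_two_notMem : rung 2 ∉ V 0 := by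
    obtain hc1 | rfl | rfl := le_rung_one_or_eq_rung_zero_or_eq_rung_two c
    exacts [absurd (hc (by simp) hc1) rung_one_notMem, absurd rung_zero_mem hc0, hc0]
  refine ⟨fun h => ?_, fun h => h ▸ rung_zero_mem⟩
  obtain hy1 | rfl | rfl := le_rung_one_or_eq_rung_zero_or_eq_rung_two y
  exacts [absurd (hp hy h hy1) rung_one_notMem, rfl, absurd h rung_two_notMem]

theorem mem_zero_iff_of_mem_one (h : (Formula.ladder n).box.Sat V x) {y : Ladder.{u} m}
    (hxy : x ≤ y) (hy : y ∈ V 1) : ∀ z, x ≤ z → (z ∈ V 0 ↔ z = rung 0) := by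
  refine mem_zero_iff_eq_rung_zero (fun z hz => (h z hz).1) fun k hk => ?_
  have hk' : (k : ℕ∞) + 2 ≤ n + 4 := by
    norm_cast
    omega
  have y_looksLike := looksLike_twin.{u, u} (fun z hz => h z (hxy.trans hz)) hy
  obtain ⟨z, hz, hzk⟩ := y_looksLike.back (twin_le_rung_iff.2 hk')
  exact ⟨z, hxy.trans hz, (LooksLike.sat_rung_iff hzk).2 rfl⟩

theorem height_eq_of_mem_one (h : (Formula.ladder n).box.Sat V x) (hx : x ∈ V 1) :
    x.height = (n + 4 : ℕ) :=
  (sat_rung (mem_zero_iff_of_mem_one h le_rfl hx) _ le_rfl).1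
    ((looksLike_twin.{u, u} h hx).sat_rung_iff.2 rfl)

theorem eq_root_of_sat_root (h : (Formula.ladder n).box.Sat V x) (hx : Formula.root.Sat V x) :
    m = n ∧ x = root := by
  -- `x` sees two worlds of height `n + 4`, and only the twin and one rung share a height.
  obtain ⟨y, hxy, hy⟩ := sat_dia.1 hx.2
  obtain ⟨z, hxz, hz, hzq⟩ := sat_dia.1 ((h x le_rfl).2.2 hx)
  have height_y := height_eq_of_mem_one (fun w hw => h w (hxy.trans hw)) hy
  have height_z := (sat_rung (mem_zero_iff_of_mem_one h hxy hy) _ hxz).1 hz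
  have hne : y ≠ z := by
    rintro rfl
    exact hzq hy
  have eq_root (hmn : n + 4 = m + 4) (hrung : x ≤ rung (n + 4 : ℕ)) (htwin : x ≤ twin) :
      m = n ∧ x = root := by
    refine ⟨by omega, (le_twin_iff.1 htwin).resolve_right ?_⟩
    rintro rfl
    rw [twin_le_rung_iff] at hrung
    norm_cast at hrung
    omega
  obtain rfl | ⟨hmn, rfl⟩ := height_eq_coe_iff.1 height_y <;>
    obtain rfl | ⟨hmn', rfl⟩ := height_eq_coe_iff.1 height_z
  exacts [absurd rfl hne, eq_root hmn' hxy hxz, eq_root hmn hxz hxy, absurd rfl hne]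

theorem mem_one_iff_of_sat_root (h : (Formula.ladder n).box.Sat V root)
    (hroot : Formula.root.Sat V root) (x : Ladder.{u} m) : x ∈ V 1 ↔ x = twin := by
  obtain ⟨rfl, -⟩ := eq_root_of_sat_root h hroot
  have eq_twin {x : Ladder.{u} m} (hx : x ∈ V 1) : x = twin := by
    have h_above {x : Ladder.{u} m} (y) (_ : x ≤ y) := h y (root_le y)
    obtain rfl | ⟨-, rfl⟩ := height_eq_coe_iff.1 (height_eq_of_mem_one h_above hx)
    · have sat_root : Formula.root.Sat V (rung (m + 6 : ℕ)) := by
        refine ⟨fun hq => ?_, sat_dia.2 ⟨_, le_rung le_rfl, hx⟩⟩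
        have := height_eq_of_mem_one h_above hq
        simp only [height] at this
        norm_cast at this
        omega
      cases (eq_root_of_sat_root h_above sat_root).2
    · rfl
  obtain ⟨y, -, hy⟩ := sat_dia.1 hroot.2
  exact ⟨eq_twin, fun hx => hx ▸ eq_twin hy ▸ hy⟩

theorem exists_looksLike (h : (Formula.ladder n).box.Sat V x) :
    ∃ y : Ladder.{u} n, LooksLike V x y := by
  by_cases hx : x ∈ V 1
  · exact ⟨twin, looksLike_twin h hx⟩
  by_cases hq : ∃ y, x ≤ y ∧ y ∈ V 1
  · have hroot : Formula.root.Sat V x := ⟨hx, sat_dia.2 hq⟩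
    obtain ⟨rfl, rfl⟩ := eq_root_of_sat_root h hroot
    obtain ⟨y, hy, hyq⟩ := hq
    have mem_zero_iff (z) := mem_zero_iff_of_mem_one h hy hyq z (root_le z)
    have mem_one_iff := mem_one_iff_of_sat_root h hroot
    refine ⟨root, Eq, ⟨?_, ?_, ?_⟩, rfl⟩
    · rintro z _ rfl
      simp [mem_zero_iff, mem_one_iff, mem_val_zero, mem_val_one]
    · rintro z _ rfl t ht
      exact ⟨t, ht, rfl⟩
    · rintro z _ rfl t ht
      exact ⟨t, ht, rfl⟩
  · push Not at hq
    obtain ⟨k, hk⟩ := exists_looksLike_rung.{u} n (fun y hy => (h y hy).1) hq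
    exact ⟨rung k, hk⟩

theorem sat_of_sat_val (h : (Formula.ladder n).box.Sat V x) {φ : Formula} (hφ : φ.vars ⊆ {0, 1})
    (hsat : ∀ y : Ladder.{u} n, φ.Sat (val n) y) : φ.Sat V x :=
  let ⟨y, hy⟩ := exists_looksLike h
  (hy.sat_iff hφ).2 (hsat y)

end Root

end Ladder

/-! ### The variety generated by the ladders -/

section LadderAlgebras

open Ladder

variable {m n : ℕ}

/-- The variety generated by the complex algebras of all ladders. -/
def ladderVariety : Set Alg.{u} := Mod {θ | ∀ m, Valid (complexAlgebra (Ladder.{u} m)) θ}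

theorem val_mem_definable (n i : ℕ) :
    val n i ∈ definable (α := complexAlgebra (Ladder.{u} n)) (val n) {0, 1} := by
  have val_eq : val.{u} n i = val n 1 ∨ val.{u} n i = val n 0 := by
    by_cases h : i = 1 <;> simp [val, h]
  obtain h | h := val_eq <;> rw [h]
  exacts [mem_definable (α := complexAlgebra _) (by simp),
    mem_definable (α := complexAlgebra _) (by simp)]

/-- The algebra of the sets of worlds of the `n`-th ladder that are definable from `p₀` and `p₁`. -/
def ladderAlgebra (n : ℕ) : Alg.{u} :=
  (isSubuniverse_definable (α := complexAlgebra (Ladder n)) (val n) {0, 1}).toAlg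
    ⟨_, val_mem_definable n 0⟩

/-- The set of worlds that an element of the ladder algebra is. -/
def worlds (a : ladderAlgebra.{u} n) : Set (Ladder.{u} n) := a.1

/-- The valuation `Ladder.val` in the algebra of definable sets. -/
def ladderVal (n i : ℕ) : ladderAlgebra.{u} n := ⟨val n i, val_mem_definable n i⟩

/-- The characteristic formula of the `n`-th ladder algebra: its opremum is the complement of the
root. -/
def ladderFormula (n : ℕ) : Formula := (Formula.ladder n).boxImp (.neg Formula.root)

theorem worlds_eval_ladderVal (φ : Formula) :
    worlds (φ.eval (ladderVal.{u} n)) = {x | φ.Sat (val n) x} :=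
  (IsSubuniverse.coe_eval (α := complexAlgebra _) _ _ _ φ).trans (eval_complexAlgebra _ φ)

theorem eq_top_iff_forall_mem_worlds {a : ladderAlgebra.{u} n} : a = ⊤ ↔ ∀ x, x ∈ worlds a :=
  Subtype.ext_iff.trans Set.eq_univ_iff_forall

theorem eval_ladderVal_eq_top_iff {φ : Formula} :
    φ.eval (ladderVal.{u} n) = ⊤ ↔ ∀ x : Ladder.{u} n, φ.Sat (val n) x := by
  rw [eq_top_iff_forall_mem_worlds, worlds_eval_ladderVal]
  rfl

theorem ladderAlgebra_mem_ladderVariety (n : ℕ) : ladderAlgebra.{u} n ∈ ladderVariety.{u} :=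
  fun _ hθ => (hθ n).toAlg _ _

theorem isOpremum_eval_neg_root (n : ℕ) :
    IsOpremum ((Formula.neg Formula.root).eval (ladderVal.{u} n)) := by
  have mem_iff (x : Ladder.{u} n) :
      x ∈ worlds ((Formula.neg Formula.root).eval (ladderVal n)) ↔ x ≠ root := by
    rw [worlds_eval_ladderVal]
    exact not_congr sat_root_val
  refine ⟨⟨le_antisymm (box_le _) fun x hx y hxy => (mem_iff y).2 ?_, fun h => ?_⟩, ?_⟩
  · rintro rfl
    exact (mem_iff x).1 hx (le_antisymm hxy (root_le x))
  · exact (mem_iff root).1 (eq_top_iff_forall_mem_worlds.1 h root) rfl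
  · rintro a ⟨ha, ha_ne⟩ x hx
    refine (mem_iff x).2 ?_
    rintro rfl
    have root_mem : root ∈ worlds (box a) := ha.symm ▸ hx
    exact ha_ne (eq_top_iff_forall_mem_worlds.2 fun y => root_mem y (root_le y))

theorem defines_ladderAlgebra (n : ℕ) :
    Defines ladderVariety.{u} (ladderAlgebra n) {0, 1} (Formula.ladder n) (ladderVal n) where
  vars_subset := Formula.vars_ladder_subset n
  generates := generates_of_coe_eq _ fun _ => rfl
  eval_eq_top := eval_ladderVal_eq_top_iff.2 sat_ladder_val
  derives _ hψ hval _ h𝔅 := h𝔅 _ fun _ => valid_complexAlgebra.2 fun _ _ hx _ hxy =>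
    sat_of_sat_val (fun z hyz => hx z (hxy.trans hyz)) hψ (eval_ladderVal_eq_top_iff.1 hval)

theorem isCharacteristicFormula_ladderFormula (n : ℕ) :
    IsCharacteristicFormula ladderVariety.{u} (ladderAlgebra n) (ladderFormula n) :=
  ⟨ladderAlgebra_mem_ladderVariety n, (isOpremum_eval_neg_root n).isSubdirectlyIrreducible,
    {0, 1}, Formula.ladder n, .neg Formula.root, ladderVal n, defines_ladderAlgebra n,
    Formula.vars_root_subset, isOpremum_eval_neg_root n, rfl⟩

instance (n : ℕ) : Infinite (ladderAlgebra.{u} n) := by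
  refine Infinite.of_injective (fun k => (Formula.rung k).eval (ladderVal n)) fun j k h => ?_
  have sat_iff := Set.ext_iff.1 (congrArg worlds h) (rung j)
  simp only [worlds_eval_ladderVal, Set.mem_ofPred_eq, sat_rung_val, height] at sat_iff
  simpa using sat_iff

theorem valid_ladderFormula (h : m ≠ n) : Valid (ladderAlgebra.{u} m) (ladderFormula n) := by
  have valid : Valid (complexAlgebra (Ladder.{u} m)) (ladderFormula n) :=
    valid_complexAlgebra.2 fun V x hx y hxy hroot =>
      h (eq_root_of_sat_root (fun z hyz => hx z (hxy.trans hyz)) hroot).1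
  exact valid.toAlg _ _

end LadderAlgebras

/-! ### The number of varieties -/

section Counting

instance : Countable Formula := by
  let code : Formula → ℕ := Formula.rec (Nat.pair 0)
    (fun _ _ i j => Nat.pair 1 (Nat.pair i j)) (fun _ _ i j => Nat.pair 2 (Nat.pair i j))
    (fun _ _ i j => Nat.pair 3 (Nat.pair i j)) (fun _ i => Nat.pair 4 i) (fun _ i => Nat.pair 5 i)
  refine Function.Injective.countable (f := code) fun φ => ?_
  induction φ <;> rintro (_ | _ | _ | _ | _ | _) h <;> simp_all [code] <;> grind

theorem mk_isVariety_le : Cardinal.mk {V : Set Alg.{u} | IsVariety V} ≤ Cardinal.continuum := by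
  have mk_set_formula : Cardinal.mk (Set Formula) ≤ Cardinal.continuum := by
    rw [Cardinal.mk_set, ← Cardinal.two_power_aleph0]
    exact Cardinal.power_le_power_left two_ne_zero Cardinal.mk_le_aleph0
  have surjective : Function.Surjective
      fun Γ : Set Formula => (⟨Mod Γ, Γ, rfl⟩ : {V : Set Alg.{u} | IsVariety V}) := by
    rintro ⟨_, Γ, rfl⟩
    exact ⟨Γ, rfl⟩
  have h := Cardinal.lift_mk_le_lift_mk_of_surjective surjective
  rw [Cardinal.lift_uzero] at h
  exact h.trans (Cardinal.lift_le_continuum.2 mk_set_formula)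

theorem injective_Mod_image {ι : Type*} {𝔄 : ι → Alg.{u}} {χ : ι → Formula}
    (not_valid : ∀ i, ¬ Valid (𝔄 i) (χ i)) (valid : ∀ i j, i ≠ j → Valid (𝔄 i) (χ j)) :
    Function.Injective fun I => Mod.{u} (χ '' I) := by
  have mem_iff (i : ι) (I : Set ι) : 𝔄 i ∈ Mod (χ '' I) ↔ i ∉ I := by
    refine ⟨fun h hi => not_valid i (h _ ⟨i, hi, rfl⟩), ?_⟩
    rintro hi _ ⟨j, hj, rfl⟩
    exact valid i j fun hij => hi (hij ▸ hj)
  intro I J (h : Mod (χ '' I) = Mod (χ '' J))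
  ext i
  rw [← not_iff_not, ← mem_iff, h, mem_iff]

theorem continuum_le_mk {M : Set Alg.{u}} (hM : IsVariety M) {𝔄 : ℕ → Alg.{u}}
    [∀ n, Infinite (𝔄 n)] {χ : ℕ → Formula} (hχ : ∀ n, IsCharacteristicFormula M (𝔄 n) (χ n))
    (valid : ∀ m n, m ≠ n → Valid (𝔄 m) (χ n)) :
    Cardinal.continuum ≤ Cardinal.mk {V : Set Alg.{u} | IsVariety V ∧
      DefinedByCharacteristicFormulas M V ∧ ¬ AxiomatizedByJankovFormulas V} := by
  have exists_isCharacteristicFormula (I : Set ℕ) :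
      ∀ φ ∈ χ '' I, ∃ 𝔅 : Alg.{u}, Infinite 𝔅 ∧ IsCharacteristicFormula M 𝔅 φ := by
    rintro _ ⟨n, -, rfl⟩
    exact ⟨𝔄 n, inferInstance, hχ n⟩
  let F : ({∅}ᶜ : Set (Set ℕ)) → {V : Set Alg.{u} | IsVariety V ∧
      DefinedByCharacteristicFormulas M V ∧ ¬ AxiomatizedByJankovFormulas V} := fun I =>
    ⟨Mod (χ '' I), ⟨_, rfl⟩, ⟨_, exists_isCharacteristicFormula I, rfl⟩,
      not_axiomatizedByJankovFormulas hM ((Set.nonempty_iff_ne_empty.2 I.2).image χ)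
        (exists_isCharacteristicFormula I)⟩
  have injective : Function.Injective F := fun I J h =>
    Subtype.ext (injective_Mod_image (fun n => (hχ n).not_valid) valid (congrArg Subtype.val h))
  have mk_nonempty : Cardinal.mk ({∅}ᶜ : Set (Set ℕ)) = Cardinal.continuum := by
    rw [Cardinal.mk_compl_of_infinite _ (by simpa using Cardinal.nat_lt_continuum 1),
      Cardinal.mk_set_nat]
  have h := Cardinal.lift_mk_le_lift_mk_of_injective injective
  rwa [mk_nonempty, Cardinal.lift_continuum, Cardinal.lift_uzero] at h

end Counting

end InteriorAlgebra

theorem theorem7p5 :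
    ∃ M : Set InteriorAlgebra.Alg.{u}, InteriorAlgebra.IsVariety M ∧
      Cardinal.mk {V : Set InteriorAlgebra.Alg.{u} |
        InteriorAlgebra.IsVariety V ∧
        InteriorAlgebra.DefinedByCharacteristicFormulas M V ∧
        ¬ InteriorAlgebra.AxiomatizedByJankovFormulas V} = Cardinal.continuum := by
  open InteriorAlgebra in
  refine ⟨ladderVariety, ⟨_, rfl⟩, le_antisymm ?_ ?_⟩
  · exact (Cardinal.mk_le_mk_of_subset fun V hV => hV.1).trans mk_isVariety_le
  · exact continuum_le_mk ⟨_, rfl⟩ isCharacteristicFormula_ladderFormula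
      fun _ _ => valid_ladderFormula
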